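/- For a finite graph $G=(V,E)$ (vertices in different components are at distance $\infty$), a set $R\subseteq V$ and a vertex $v$, the multiset signature of $v$ with respect to $R$ is the vector $\mathbf{m}_R(v)=\big(|\{w\in R : d_G(v,w)=k\}|\big)_{k}$, where $k$ runs over the distance values from $0$ to the diameter of $G$. The set $R$ is multiset resolving for $G$ if $\mathbf{m}_R(v)\ne \mathbf{m}_R(w)$ for all distinct $v,w\in V$. For $x\in(0,1]$ and $y\in[0,1]$ let $$f_x(y)=\sum_{i=0}^{\lfloor 1/x\rfloor}\max\{ix+y-1,\,0\}.$$ Theorem. Fix $x\in(0,1/2]$. The equation $f_x(y)=1$ has a unique solution $y_1=y_1(x)$ in $(0,1)$. Moreover, if $d=(n-1)p=n^{x+O(1/\log n)}$, then with high probability the binomial random graph $\mathcal{G}(n,p)$ has no multiset resolving set of size less than $n^{y_1+O(1/\log n)}$. Explicitly: for every real $A$ there is a constant $C>0$, depending only on $x$ and $A$, such that for every sequence $p=p(n)\in[0,1]$ satisfying $n^{x-A/\log n}\le (n-1)p\le n^{x+A/\log n}$ for all sufficiently large $n$, the probability that $\mathcal{G}(n,p)$ has no multiset resolving set $R$ with $|R|<n^{y_1-C/\log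 n}$ tends to $1$ as $n\to\infty$. -/

import Mathlib

open Filter Topology

namespace MultisetDim

/-- The sphere `S_k(v)`: the vertices at graph distance exactly `k` from `v`.  Distances take
values in `ℕ∞`; two vertices in different components are at distance `⊤`. -/
def sphere {V : Type*} (G : SimpleGraph V) (k : ℕ∞) (v : V) : Set V :=
  {w | G.edist v w = k}

/-- The multiset signature `m_R(v) = (|S_k(v) ∩ R|)_{0 ≤ k ≤ diam G}` of the vertex `v`.
For a finite connected graph the index set is `{0, 1, …, diam G}`; for a disconnected graph it
also contains the value `⊤`. -/
noncomputable def multisetSignature {V : Type*} (G : SimpleGraph V) (R : Finset V) (v : V) :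
    Set.Iic G.ediam → ℕ :=
  fun k => (sphere G (k : ℕ∞) v ∩ (R : Set V)).ncard

/-- `R` is multiset resolving for `G` if distinct vertices have distinct multiset signatures. -/
def IsMultisetResolving {V : Type*} (G : SimpleGraph V) (R : Finset V) : Prop :=
  ∀ v w : V, v ≠ w → multisetSignature G R v ≠ multisetSignature G R w

/-- The function `f_x(y) = ∑_{i=0}^{⌊1/x⌋} max {i x + y - 1, 0}`. -/
noncomputable def exponentFun (x y : ℝ) : ℝ :=
  ∑ i ∈ Finset.range (⌊1 / x⌋₊ + 1), max ((i : ℝ) * x + y - 1) 0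

end MultisetDim

/-! The bound is a count of signatures. Write d = (n-1)p and l = ⌊1/x⌋ + 1. With high probability
all degrees are O(d) and all distances are at most l. Since the sphere counts of a vertex sum to
|R|, those at distances 0, ..., l-1 determine the one at distance l. By double counting, the average
of |S_i(v) ∩ R| is at most |R| O(d)^i / n, which is of order n^(ix+y-1) when |R| is about n^y. By
Markov's inequality at least half of the vertices have every count below a constant multiple of its
average bound, so they share at most about n^(f_x(y)) signatures: factors with negative exponent
contribute only the value 0. At y = y₁ this is about n, and shrinking |R| by a constant factor
e^(-C) leaves fewer than n/2 signatures, a contradiction. `card_le_of_isMultisetResolving` is the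
count, `exists_eventually_le_card_of_isMultisetResolving` fixes the constants.

The typical structure is `le_real_edist_le_and_ncard_neighborSet_le`. Degrees are handled by a union
bound. For distances, expansion makes the ball of radius l-1 about w in G - v large; the edges at v
are independent of it, and lx > 1 makes it unlikely that v misses it. -/

namespace MultisetDim

open MeasureTheory Measure ProbabilityTheory unitInterval SimpleGraph

/-! ### Independence of edges in the binomial random graph. -/

section Probability

variable {V : Type*}

instance [Finite V] : DiscreteMeasurableSpace (SimpleGraph V) where
  forall_measurableSet S := by
    rw [← measurableEmbedding_edgeSet.measurableSet_image]
    exact (Set.toFinite _).measurableSet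

/-- The law of a single potential edge in the binomial random graph. -/
noncomputable def edgeLaw (p : I) (e : Sym2 V) : Measure Prop :=
  toNNReal p • dirac (¬ e.IsDiag) + toNNReal (σ p) • dirac False

instance (p : I) (e : Sym2 V) : IsProbabilityMeasure (edgeLaw p e) := by
  constructor
  simp [edgeLaw]

lemma edgeLaw_true (p : I) {e : Sym2 V} (he : ¬ e.IsDiag) :
    edgeLaw p e {True} = toNNReal p := by
  simp [edgeLaw, he]

lemma edgeLaw_false (p : I) {e : Sym2 V} (he : ¬ e.IsDiag) :
    edgeLaw p e {False} = toNNReal (σ p) := by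
  simp [edgeLaw, he]

/-- The graph whose edges are the non-diagonal pairs selected by `ω`. -/
def graphOf (ω : Sym2 V → Prop) : SimpleGraph V := fromEdgeSet {e | ω e}

lemma mem_edgeSet_graphOf {ω : Sym2 V → Prop} {e : Sym2 V} (he : ¬ e.IsDiag) :
    e ∈ (graphOf ω).edgeSet ↔ ω e := by
  simp [graphOf, he]

lemma measurable_graphOf : Measurable (graphOf (V := V)) :=
  measurable_fromEdgeSet.comp <| measurable_set_iff.2 fun e => by simpa using measurable_pi_apply e

variable [Fintype V]

lemma binomialRandom_eq_map_graphOf (p : I) :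
    binomialRandom V p = (infinitePi (edgeLaw (V := V) p)).map graphOf := by
  rw [binomialRandom_eq_map, setBernoulli_eq_map, map_map measurable_fromEdgeSet]
  · rfl
  · exact measurable_set_iff.2 fun e => by simpa using measurable_pi_apply e

lemma binomialRandom_real_apply (p : I) (S : Set (SimpleGraph V)) :
    (binomialRandom V p).real S = (infinitePi (edgeLaw (V := V) p)).real (graphOf ⁻¹' S) := by
  rw [binomialRandom_eq_map_graphOf, map_measureReal_apply measurable_graphOf .of_discrete]

lemma binomialRandom_real_forall_mem (p : I) (F : Finset (Sym2 V)) (hF : ∀ e ∈ F, ¬ e.IsDiag) :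
    (binomialRandom V p).real {G | ∀ e ∈ F, e ∈ G.edgeSet} = (p : ℝ) ^ F.card := by
  have h : graphOf ⁻¹' {G : SimpleGraph V | ∀ e ∈ F, e ∈ G.edgeSet}
      = Set.pi (F : Set (Sym2 V)) fun _ => {True} := by
    ext ω
    simp only [Set.mem_preimage, Set.mem_ofPred_eq, Set.mem_pi, Finset.mem_coe,
      Set.mem_singleton_iff, eq_iff_iff, iff_true]
    exact forall₂_congr fun e he => mem_edgeSet_graphOf (hF e he)
  rw [binomialRandom_real_apply, h, measureReal_def, infinitePi_pi _ (by simp),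
    Finset.prod_congr rfl fun e he => edgeLaw_true p (hF e he)]
  simp

/-- `hQ` says that `Q` is determined by the edges outside `F`, so it is independent of the edges in
`F`. This permits revealing part of the graph while the edges at one vertex stay fresh. -/
lemma binomialRandom_real_forall_notMem_inter (p : I) (F : Finset (Sym2 V))
    (hF : ∀ e ∈ F, ¬ e.IsDiag) (Q : Set (SimpleGraph V))
    (hQ : ∀ G G' : SimpleGraph V, (∀ e ∉ F, e ∈ G.edgeSet ↔ e ∈ G'.edgeSet) → G ∈ Q → G' ∈ Q) :
    (binomialRandom V p).real (Q ∩ {G | ∀ e ∈ F, e ∉ G.edgeSet})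
      = (binomialRandom V p).real Q * (1 - p : ℝ) ^ F.card := by
  classical
  have hind := (iIndepFun_infinitePi (P := edgeLaw (V := V) p) (X := fun _ ω => ω)
    fun _ => measurable_id).indepFun_finset Fᶜ F disjoint_compl_left fun i => measurable_pi_apply i
  -- Padding with `False` on `F` is harmless, as `Q` does not see those edges.
  let ext (η : (Fᶜ : Finset (Sym2 V)) → Prop) : Sym2 V → Prop :=
    fun e => ∃ h : e ∈ Fᶜ, η ⟨e, h⟩
  have hA : graphOf ⁻¹' Q = (fun (ω : Sym2 V → Prop) (i : (Fᶜ : Finset (Sym2 V))) => ω i) ⁻¹'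
      {η | graphOf (ext η) ∈ Q} := by
    ext ω
    have key : ∀ e ∉ F, e ∈ (graphOf ω).edgeSet ↔
        e ∈ (graphOf (ext fun i : (Fᶜ : Finset (Sym2 V)) => ω i)).edgeSet := by
      intro e he
      simp [graphOf, ext, he]
    exact ⟨fun h => hQ _ _ key h, fun h => hQ _ _ (fun e he => (key e he).symm) h⟩
  have hB : graphOf ⁻¹' {G : SimpleGraph V | ∀ e ∈ F, e ∉ G.edgeSet} =
      (fun (ω : Sym2 V → Prop) (i : F) => ω i) ⁻¹' {η | ∀ i, η i = False} := by
    ext ω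
    simp only [Set.mem_preimage, Set.mem_ofPred_eq, eq_iff_iff, iff_false, Subtype.forall]
    exact forall₂_congr fun e he => not_congr (mem_edgeSet_graphOf (hF e he))
  have hB' : graphOf ⁻¹' {G : SimpleGraph V | ∀ e ∈ F, e ∉ G.edgeSet} =
      Set.pi (F : Set (Sym2 V)) fun _ => {False} := by
    ext ω
    simp only [Set.mem_preimage, Set.mem_ofPred_eq, Set.mem_pi, Finset.mem_coe,
      Set.mem_singleton_iff, eq_iff_iff, iff_false]
    exact forall₂_congr fun e he => not_congr (mem_edgeSet_graphOf (hF e he))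
  have hPB : (infinitePi (edgeLaw (V := V) p)).real
      (graphOf ⁻¹' {G : SimpleGraph V | ∀ e ∈ F, e ∉ G.edgeSet}) = (1 - p : ℝ) ^ F.card := by
    rw [hB', measureReal_def, infinitePi_pi _ (by simp),
      Finset.prod_congr rfl fun e he => edgeLaw_false p (hF e he)]
    simp
  rw [binomialRandom_real_apply, binomialRandom_real_apply, ← hPB, Set.preimage_inter, hA, hB,
    measureReal_def, measureReal_def, measureReal_def,
    hind.measure_inter_preimage_eq_mul _ _ .of_discrete .of_discrete, ENNReal.toReal_mul]

lemma binomialRandom_real_forall_notMem (p : I) (F : Finset (Sym2 V))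
    (hF : ∀ e ∈ F, ¬ e.IsDiag) :
    (binomialRandom V p).real {G | ∀ e ∈ F, e ∉ G.edgeSet} = (1 - p : ℝ) ^ F.card := by
  simpa using binomialRandom_real_forall_notMem_inter p F hF Set.univ (by simp)

end Probability

end MultisetDim

namespace MultisetDim

/-! ### Sphere counts and the number of signatures. -/

section Deterministic

variable {V : Type*}

lemma multisetSignature_congr {G : SimpleGraph V} {R : Finset V} {v w : V}
    (h : ∀ k : ℕ∞, (sphere G k v ∩ (R : Set V)).ncard = (sphere G k w ∩ (R : Set V)).ncard) :
    multisetSignature G R v = multisetSignature G R w :=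
  funext fun k => h k

/-- The vertex next to the endpoint on a geodesic to `w` lies on the previous sphere. -/
lemma sphere_succ_subset (G : SimpleGraph V) (k : ℕ) (w : V) :
    sphere G ((k + 1 : ℕ) : ℕ∞) w ⊆ ⋃ u ∈ sphere G (k : ℕ∞) w, G.neighborSet u := by
  intro u hu
  rw [sphere, Set.mem_ofPred_eq, SimpleGraph.edist_comm] at hu
  obtain ⟨q, hq⟩ := SimpleGraph.exists_walk_of_edist_eq_coe hu
  cases q with
  | nil => simp at hq
  | @cons _ a _ h q =>
    have hq' : q.length = k := by simpa using hq
    have h1 : G.edist a w ≤ k := hq' ▸ q.edist_le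
    have h2 : G.edist u w ≤ 1 + G.edist a w :=
      (G.edist_triangle (v := a)).trans (by rw [SimpleGraph.edist_eq_one_iff_adj.2 h])
    have h3 : G.edist w a = k := by
      rw [SimpleGraph.edist_comm]
      obtain ⟨m, hm⟩ := ENat.ne_top_iff_exists.1 (ne_top_of_le_ne_top (ENat.natCast_ne_top k) h1)
      rw [hu, ← hm] at h2
      rw [← hm] at h1 ⊢
      norm_cast at h1 h2 ⊢
      omega
    simp only [Set.mem_iUnion]
    exact ⟨a, h3, h.symm⟩

lemma ncard_sphere_inter_top {G : SimpleGraph V} {l : ℕ} (hl : ∀ u v, G.edist u v ≤ l)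
    (R : Finset V) (v : V) :
    ∑ k ∈ Finset.range (l + 1), (sphere G (k : ℕ∞) v ∩ (R : Set V)).ncard = R.card := by
  classical
  have h1 : ∀ k : ℕ, (sphere G (k : ℕ∞) v ∩ (R : Set V)).ncard =
      (R.filter fun w => (G.edist v w).toNat = k).card := by
    intro k
    rw [← Set.ncard_coe_finset]
    congr 1; ext w
    have hne : G.edist v w ≠ ⊤ := ne_top_of_le_ne_top (ENat.natCast_ne_top l) (hl v w)
    obtain ⟨a, ha⟩ := ENat.ne_top_iff_exists.1 hne
    simp [sphere, ← ha, and_comm]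
  simp_rw [h1]
  refine (Finset.card_eq_sum_card_fiberwise fun w _ => ?_).symm
  have hne : G.edist v w ≠ ⊤ := ne_top_of_le_ne_top (ENat.natCast_ne_top l) (hl v w)
  obtain ⟨a, ha⟩ := ENat.ne_top_iff_exists.1 hne
  have := hl v w
  rw [← ha] at this
  simp only [← ha, ENat.toNat_natCast, Finset.coe_range, Set.mem_Iio]
  exact Nat.lt_succ_of_le (by exact_mod_cast this)

/-- For a resolving set in a graph of diameter at most `l`, the first `l` sphere counts
already determine a vertex. -/
lemma eq_of_forall_ncard_sphere_inter_eq {G : SimpleGraph V} {l : ℕ}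
    (hl : ∀ u v, G.edist u v ≤ l) {R : Finset V} (hR : IsMultisetResolving G R) {v w : V}
    (h : ∀ k < l, (sphere G (k : ℕ∞) v ∩ (R : Set V)).ncard =
      (sphere G (k : ℕ∞) w ∩ (R : Set V)).ncard) : v = w := by
  by_contra hvw
  refine hR v w hvw (multisetSignature_congr fun k => ?_)
  have hempty : ∀ k : ℕ∞, ↑l < k → ∀ v, sphere G k v = ∅ := fun k hk v => by
    ext u
    simp only [sphere, Set.mem_ofPred_eq, Set.mem_empty_iff_false, iff_false]
    exact ((hl v u).trans_lt hk).ne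
  rcases lt_trichotomy k l with hk | hk | hk
  · obtain ⟨a, rfl⟩ := ENat.ne_top_iff_exists.1 hk.ne_top
    exact h a (by exact_mod_cast hk)
  -- The count at distance `l` is `R.card` minus the earlier counts, so it carries no information.
  · have h1 := ncard_sphere_inter_top hl R v
    rw [← ncard_sphere_inter_top hl R w, Finset.sum_range_succ, Finset.sum_range_succ,
      Finset.sum_congr rfl fun k hk => h k (Finset.mem_range.1 hk)] at h1
    subst hk
    exact Nat.add_left_cancel h1
  · simp [hempty k hk]

variable [Fintype V]

lemma ncard_sphere_le (G : SimpleGraph V) {D : ℝ} (hD : 0 ≤ D)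
    (hG : ∀ v, ((G.neighborSet v).ncard : ℝ) ≤ D) (k : ℕ) (w : V) :
    ((sphere G (k : ℕ∞) w).ncard : ℝ) ≤ D ^ k := by
  classical
  induction k with
  | zero =>
    have : sphere G ((0 : ℕ) : ℕ∞) w = {w} := by
      ext u
      rw [sphere, Set.mem_ofPred_eq, Nat.cast_zero, SimpleGraph.edist_eq_zero_iff,
        Set.mem_singleton_iff, eq_comm]
    rw [this, Set.ncard_singleton, pow_zero, Nat.cast_one]
  | succ k ih =>
    have hfin := (sphere G (k : ℕ∞) w).toFinite
    have h1 : (sphere G ((k + 1 : ℕ) : ℕ∞) w).ncard ≤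
        ∑ u ∈ hfin.toFinset, (G.neighborSet u).ncard := by
      refine (Set.ncard_le_ncard (sphere_succ_subset G k w) (Set.toFinite _)).trans ?_
      have := Finset.set_ncard_biUnion_le hfin.toFinset fun u => G.neighborSet u
      simpa using this
    calc ((sphere G ((k + 1 : ℕ) : ℕ∞) w).ncard : ℝ)
        ≤ ∑ u ∈ hfin.toFinset, ((G.neighborSet u).ncard : ℝ) := by exact_mod_cast h1
      _ ≤ ∑ u ∈ hfin.toFinset, D := Finset.sum_le_sum fun u _ => hG u
      _ = (sphere G (k : ℕ∞) w).ncard * D := by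
        rw [Finset.sum_const, nsmul_eq_mul, Set.ncard_eq_toFinset_card _ hfin]
      _ ≤ D ^ k * D := by gcongr
      _ = D ^ (k + 1) := (pow_succ _ _).symm

/-- Double counting of pairs at distance `k`, by symmetry of distance. -/
lemma sum_ncard_sphere_inter (G : SimpleGraph V) (R : Finset V) (k : ℕ∞) :
    ∑ v, (sphere G k v ∩ (R : Set V)).ncard = ∑ w ∈ R, (sphere G k w).ncard := by
  classical
  have h1 : ∀ v, (sphere G k v ∩ (R : Set V)).ncard = ∑ w ∈ R, if G.edist v w = k then 1 else 0 := by
    intro v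
    rw [Finset.sum_boole, Nat.cast_id, ← Set.ncard_coe_finset]
    congr 1; ext w; simp [sphere, and_comm]
  have h2 : ∀ w, (sphere G k w).ncard = ∑ v, if G.edist v w = k then 1 else 0 := by
    intro w
    rw [Finset.sum_boole, Nat.cast_id, ← Set.ncard_coe_finset]
    congr 1; ext v; simp [sphere, SimpleGraph.edist_comm]
  simp_rw [h1, h2]
  exact Finset.sum_comm

/-- If a resolving set is too small, typical vertices realise too few signatures. -/
theorem card_le_of_isMultisetResolving {G : SimpleGraph V} {l : ℕ}
    (hl : ∀ u v, G.edist u v ≤ l) {R : Finset V} (hR : IsMultisetResolving G R)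
    {D : ℝ} (hD : 0 ≤ D) (hG : ∀ v, ((G.neighborSet v).ncard : ℝ) ≤ D)
    {z : ℕ → ℝ} (hz : ∀ k < l, 0 < z k)
    (hzR : ∀ k < l, 2 * l * (R.card * D ^ k) ≤ z k * Fintype.card V) :
    (Fintype.card V : ℝ) ≤ 2 * ∏ k ∈ Finset.range l, ((⌊z k⌋₊ : ℝ) + 1) := by
  classical
  let c : ℕ → V → ℕ := fun k v => (sphere G (k : ℕ∞) v ∩ (R : Set V)).ncard
  let bad : ℕ → Finset V := fun k => Finset.univ.filter fun v => ⌊z k⌋₊ < c k v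
  let good : Finset V := Finset.univ.filter fun v => ∀ k < l, c k v ≤ ⌊z k⌋₊
  -- Markov's inequality; the factor `2 * l` makes the `l` bad sets together cover at most half of
  -- the vertices.
  have hbad : ∀ k < l, 2 * l * ((bad k).card : ℝ) ≤ Fintype.card V := by
    intro k hk
    have h1 : ((bad k).card : ℝ) * z k ≤ R.card * D ^ k := by
      calc ((bad k).card : ℝ) * z k = ∑ v ∈ bad k, z k := by simp
        _ ≤ ∑ v ∈ bad k, (c k v : ℝ) := Finset.sum_le_sum fun v hv =>
            ((Nat.floor_lt (hz k hk).le).1 (Finset.mem_filter.1 hv).2).le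
        _ ≤ ∑ v, (c k v : ℝ) := Finset.sum_le_sum_of_subset_of_nonneg (Finset.subset_univ _)
            fun _ _ _ => Nat.cast_nonneg _
        _ = ∑ w ∈ R, ((sphere G (k : ℕ∞) w).ncard : ℝ) := by
            exact_mod_cast sum_ncard_sphere_inter G R k
        _ ≤ ∑ w ∈ R, D ^ k := Finset.sum_le_sum fun w _ => ncard_sphere_le G hD hG k w
        _ = R.card * D ^ k := by simp
    have h2 : (2 * l * ((bad k).card : ℝ)) * z k ≤ Fintype.card V * z k := by
      calc (2 * l * ((bad k).card : ℝ)) * z k = 2 * l * ((bad k).card * z k) := by ring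
        _ ≤ 2 * l * (R.card * D ^ k) := by gcongr
        _ ≤ _ := (hzR k hk).trans_eq (mul_comm _ _)
    exact le_of_mul_le_mul_right h2 (hz k hk)
  have hcover : Fintype.card V ≤ good.card + ∑ k ∈ Finset.range l, (bad k).card := by
    have : (Finset.univ : Finset V) ⊆ good ∪ (Finset.range l).biUnion bad := by
      intro v _
      by_cases hv : v ∈ good
      · exact Finset.mem_union_left _ hv
      · simp only [good, Finset.mem_filter, Finset.mem_univ, true_and, not_forall, not_le] at hv
        obtain ⟨k, hk, hkv⟩ := hv
        exact Finset.mem_union_right _ (Finset.mem_biUnion.2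
          ⟨k, Finset.mem_range.2 hk, Finset.mem_filter.2 ⟨Finset.mem_univ _, hkv⟩⟩)
    calc Fintype.card V = (Finset.univ : Finset V).card := rfl
      _ ≤ _ := Finset.card_le_card this
      _ ≤ _ := Finset.card_union_le _ _
      _ ≤ _ := by gcongr; exact Finset.card_biUnion_le
  have hsum : 2 * ∑ k ∈ Finset.range l, ((bad k).card : ℝ) ≤ Fintype.card V := by
    rcases Nat.eq_zero_or_pos l with rfl | hl0
    · simp
    have hl0' : (0 : ℝ) < l := by exact_mod_cast hl0
    have : ∑ k ∈ Finset.range l, 2 * l * ((bad k).card : ℝ) ≤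
        ∑ _k ∈ Finset.range l, (Fintype.card V : ℝ) :=
      Finset.sum_le_sum fun k hk => hbad k (Finset.mem_range.1 hk)
    rw [← Finset.mul_sum, Finset.sum_const, Finset.card_range, nsmul_eq_mul] at this
    exact le_of_mul_le_mul_left (by linarith) hl0'
  -- The first `l` counts embed the good vertices into a box.
  have hgood : good.card ≤ ∏ k ∈ Finset.range l, (⌊z k⌋₊ + 1) := by
    have := Finset.card_le_card_of_injOn (s := good)
      (t := (Finset.range l).pi fun k => Finset.range (⌊z k⌋₊ + 1))
      (fun v k _ => c k v)
      (fun v hv => Finset.mem_coe.2 <| Finset.mem_pi.2 fun k hk => Finset.mem_range.2 <|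
        Nat.lt_succ_of_le ((Finset.mem_filter.1 (Finset.mem_coe.1 hv)).2 k (Finset.mem_range.1 hk)))
      (fun v _ w _ hvw => eq_of_forall_ncard_sphere_inter_eq hl hR fun k hk =>
        congrFun (congrFun hvw k) (Finset.mem_range.2 hk))
    simpa [Finset.card_pi] using this
  have hgood' : (good.card : ℝ) ≤ ∏ k ∈ Finset.range l, ((⌊z k⌋₊ : ℝ) + 1) := by
    exact_mod_cast hgood
  have hcover' : (Fintype.card V : ℝ) ≤ good.card + ∑ k ∈ Finset.range l, ((bad k).card : ℝ) := by
    exact_mod_cast hcover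
  linarith

/-! ### Exploration avoiding a vertex, and expansion. -/

open Classical in
/-- The set of vertices reached from `w` in at most `k` steps without visiting `v`. -/
noncomputable def exploreAvoiding (G : SimpleGraph V) (v w : V) : ℕ → Finset V
  | 0 => {w}
  | k + 1 => Finset.univ.filter fun u =>
      u ≠ v ∧ ∃ a ∈ exploreAvoiding G v w k, a = u ∨ G.Adj a u

lemma mem_exploreAvoiding_succ {G : SimpleGraph V} {v w u : V} {k : ℕ} :
    u ∈ exploreAvoiding G v w (k + 1) ↔
      u ≠ v ∧ ∃ a ∈ exploreAvoiding G v w k, a = u ∨ G.Adj a u := by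
  simp [exploreAvoiding]

lemma ne_of_mem_exploreAvoiding {G : SimpleGraph V} {v w u : V} (hvw : w ≠ v) {k : ℕ}
    (hu : u ∈ exploreAvoiding G v w k) : u ≠ v := by
  cases k with
  | zero => simp only [exploreAvoiding, Finset.mem_singleton] at hu; exact hu ▸ hvw
  | succ k => exact (mem_exploreAvoiding_succ.1 hu).1

lemma edist_le_of_mem_exploreAvoiding {G : SimpleGraph V} {v w u : V} {k : ℕ}
    (hu : u ∈ exploreAvoiding G v w k) : G.edist w u ≤ k := by
  induction k generalizing u with
  | zero => simp only [exploreAvoiding, Finset.mem_singleton] at hu; simp [hu]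
  | succ k ih =>
    obtain ⟨-, a, ha, rfl | h⟩ := mem_exploreAvoiding_succ.1 hu
    · exact (ih ha).trans (by simp)
    · refine (G.edist_triangle (v := a)).trans ?_
      rw [SimpleGraph.edist_eq_one_iff_adj.2 h]
      push_cast
      gcongr
      exact ih ha

/-- No edge at `v` is ever inspected; this is the source of independence later. -/
lemma exploreAvoiding_congr {G G' : SimpleGraph V} {v w : V} (hvw : w ≠ v)
    (h : ∀ a b, a ≠ v → b ≠ v → (G.Adj a b ↔ G'.Adj a b)) (k : ℕ) :
    exploreAvoiding G v w k = exploreAvoiding G' v w k := by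
  induction k with
  | zero => rfl
  | succ k ih =>
    ext u
    simp only [mem_exploreAvoiding_succ, ih]
    refine and_congr_right fun hu => exists_congr fun a => and_congr_right fun ha => ?_
    rw [h a u (ne_of_mem_exploreAvoiding hvw ha) hu]

/-- Every small set `S` has more than `q * |S|` closed neighbours, up to half of the graph. -/
def IsExpanding (G : SimpleGraph V) (q : ℕ) : Prop :=
  ∀ S U : Finset V, S.Nonempty → S ⊆ U → U.card ≤ min (Fintype.card V / 2) (q * S.card) →
    ∃ a ∈ S, ∃ b ∉ U, G.Adj a b

lemma IsExpanding.le_card_exploreAvoiding {G : SimpleGraph V} {q : ℕ} (hG : IsExpanding G q)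
    (hq : 1 ≤ q) {v w : V} (hvw : w ≠ v) (k : ℕ) :
    min (Fintype.card V / 2) (q ^ k) ≤ (exploreAvoiding G v w k).card := by
  classical
  induction k with
  | zero => simp [exploreAvoiding]
  | succ k ih =>
    have hmono : exploreAvoiding G v w k ⊆ exploreAvoiding G v w (k + 1) := fun u hu =>
      mem_exploreAvoiding_succ.2 ⟨ne_of_mem_exploreAvoiding hvw hu, u, hu, Or.inl rfl⟩
    have hne : (exploreAvoiding G v w k).Nonempty := by
      clear ih hmono
      induction k with
      | zero => simp [exploreAvoiding]
      | succ k ih =>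
        obtain ⟨u, hu⟩ := ih
        exact ⟨u, mem_exploreAvoiding_succ.2 ⟨ne_of_mem_exploreAvoiding hvw hu, u, hu, Or.inl rfl⟩⟩
    -- Expansion could lead to `v` itself, so `v` is added to the candidate set; the strict
    -- inequality pays for removing it again.
    have hlt : min (Fintype.card V / 2) (q * (exploreAvoiding G v w k).card) <
        (insert v (exploreAvoiding G v w (k + 1))).card := by
      by_contra! hle
      obtain ⟨a, ha, b, hb, hab⟩ := hG _ _ hne
        (hmono.trans (Finset.subset_insert v _)) hle
      rw [Finset.mem_insert, not_or] at hb
      exact hb.2 (mem_exploreAvoiding_succ.2 ⟨hb.1, a, ha, Or.inr hab⟩)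
    have hle := Nat.le_of_lt_succ (hlt.trans_le (Finset.card_insert_le _ _))
    refine le_trans ?_ hle
    refine le_min (min_le_left _ _) ?_
    calc min (Fintype.card V / 2) (q ^ (k + 1))
        ≤ q * min (Fintype.card V / 2) (q ^ k) := by
          rw [← Nat.mul_min_mul_left, pow_succ']
          exact min_le_min_right _ (Nat.le_mul_of_pos_left _ hq)
      _ ≤ _ := by gcongr

lemma edist_le_of_exists_adj_exploreAvoiding {G : SimpleGraph V} {k : ℕ}
    (h : ∀ v w, w ≠ v → ∃ a ∈ exploreAvoiding G v w k, G.Adj v a) (v w : V) :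
    G.edist w v ≤ (k + 1 : ℕ) := by
  by_cases hvw : w = v
  · simp [hvw]
  obtain ⟨a, ha, hva⟩ := h v w hvw
  refine (G.edist_triangle (v := a)).trans ?_
  rw [SimpleGraph.edist_eq_one_iff_adj.2 hva.symm]
  push_cast
  gcongr
  exact edist_le_of_mem_exploreAvoiding ha

end Deterministic

end MultisetDim

namespace MultisetDim

open MeasureTheory ProbabilityTheory unitInterval SimpleGraph

/-! ### Diameter and maximal degree of the random graph. -/

section Typical

variable {V : Type*}

lemma not_isDiag_of_mem_image_mk [DecidableEq V] {v : V} {B : Finset V} (hv : v ∉ B) :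
    ∀ e ∈ B.image (fun b => s(v, b)), ¬ e.IsDiag := by
  intro e he
  obtain ⟨b, hb, rfl⟩ := Finset.mem_image.1 he
  rw [Sym2.mk_isDiag_iff]
  rintro rfl
  exact hv hb

lemma card_image_mk [DecidableEq V] (v : V) (B : Finset V) :
    (B.image (fun b => s(v, b))).card = B.card :=
  Finset.card_image_of_injective _ fun _ _ h => Sym2.congr_right.1 h

lemma one_sub_pow_le_exp (p : I) {m : ℝ} {k : ℕ} (h : m ≤ k) :
    (1 - p : ℝ) ^ k ≤ Real.exp (-(p * m)) := by
  have h0 : (0 : ℝ) ≤ p := p.2.1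
  calc (1 - p : ℝ) ^ k ≤ Real.exp (-p) ^ k :=
        pow_le_pow_left₀ (by linarith [p.2.2]) (Real.one_sub_le_exp_neg _) _
    _ = Real.exp (-(p * k)) := by rw [← Real.exp_nat_mul]; ring_nf
    _ ≤ _ := Real.exp_le_exp.2 (neg_le_neg (by gcongr))

variable [Fintype V]

/-- Condition on the explored set being `B`: this event ignores the edges at `v`, so `v` misses `B`
with conditional probability `(1 - p) ^ B.card`. -/
lemma real_le_exp_of_forall_not_adj (p : I) {v w : V} (hvw : w ≠ v) (k m : ℕ) :
    (binomialRandom V p).real {G | m ≤ (exploreAvoiding G v w k).card ∧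
      ∀ a ∈ exploreAvoiding G v w k, ¬ G.Adj v a} ≤ Real.exp (-(p * m)) := by
  classical
  let E : Finset V → Set (SimpleGraph V) := fun B => {G | exploreAvoiding G v w k = B}
  let T : Finset (Finset V) := Finset.univ.filter fun B => m ≤ B.card ∧ v ∉ B
  have hsub : {G : SimpleGraph V | m ≤ (exploreAvoiding G v w k).card ∧
      ∀ a ∈ exploreAvoiding G v w k, ¬ G.Adj v a} ⊆
      ⋃ B ∈ T, E B ∩ {G | ∀ e ∈ B.image (fun b => s(v, b)), e ∉ G.edgeSet} := by
    rintro G ⟨hm, hG⟩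
    simp only [Set.mem_iUnion]
    refine ⟨exploreAvoiding G v w k, Finset.mem_filter.2 ⟨Finset.mem_univ _, hm, fun h =>
      ne_of_mem_exploreAvoiding hvw h rfl⟩, rfl, fun e he => ?_⟩
    obtain ⟨b, hb, rfl⟩ := Finset.mem_image.1 he
    exact hG b hb
  have hterm : ∀ B ∈ T, (binomialRandom V p).real
      (E B ∩ {G | ∀ e ∈ B.image (fun b => s(v, b)), e ∉ G.edgeSet}) ≤
      (binomialRandom V p).real (E B) * Real.exp (-(p * m)) := by
    intro B hB
    obtain ⟨-, hm, hv⟩ := Finset.mem_filter.1 hB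
    rw [binomialRandom_real_forall_notMem_inter p _ (not_isDiag_of_mem_image_mk hv), card_image_mk]
    · gcongr
      exact one_sub_pow_le_exp p (by exact_mod_cast hm)
    · intro G G' h hG
      rw [Set.mem_ofPred_eq] at hG ⊢
      rw [← hG]
      refine (exploreAvoiding_congr hvw (fun a b ha hb => ?_) k).symm
      rw [← mem_edgeSet, ← mem_edgeSet]
      refine h _ fun he => ?_
      obtain ⟨c, -, hc⟩ := Finset.mem_image.1 he
      have : v ∈ s(a, b) := hc ▸ Sym2.mem_mk_left v c
      rcases Sym2.mem_iff.1 this with h | h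
      · exact ha h.symm
      · exact hb h.symm
  have hdisj : Set.PairwiseDisjoint (T : Set (Finset V)) E := by
    intro B _ B' _ hne
    rw [Function.onFun, Set.disjoint_left]
    intro G hG hG'
    exact hne (hG.symm.trans hG')
  calc _ ≤ (binomialRandom V p).real
        (⋃ B ∈ T, E B ∩ {G | ∀ e ∈ B.image (fun b => s(v, b)), e ∉ G.edgeSet}) :=
        measureReal_mono hsub (measure_ne_top _ _)
    _ ≤ ∑ B ∈ T, (binomialRandom V p).real
        (E B ∩ {G | ∀ e ∈ B.image (fun b => s(v, b)), e ∉ G.edgeSet}) :=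
        measureReal_biUnion_finset_le _ _
    _ ≤ ∑ B ∈ T, (binomialRandom V p).real (E B) * Real.exp (-(p * m)) := Finset.sum_le_sum hterm
    _ = (binomialRandom V p).real (⋃ B ∈ T, E B) * Real.exp (-(p * m)) := by
        rw [← Finset.sum_mul, measureReal_biUnion_finset hdisj fun _ _ => .of_discrete]
    _ ≤ 1 * Real.exp (-(p * m)) := by gcongr; exact measureReal_le_one
    _ = _ := one_mul _

lemma real_exists_forall_not_adj_le (p : I) (k m : ℕ) :
    (binomialRandom V p).real {G | ∃ v w, w ≠ v ∧ m ≤ (exploreAvoiding G v w k).card ∧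
      ∀ a ∈ exploreAvoiding G v w k, ¬ G.Adj v a} ≤
      (Fintype.card V : ℝ) ^ 2 * Real.exp (-(p * m)) := by
  classical
  let T : Finset (V × V) := Finset.univ.filter fun x => x.2 ≠ x.1
  calc _ ≤ (binomialRandom V p).real (⋃ x ∈ T, {G | m ≤ (exploreAvoiding G x.1 x.2 k).card ∧
        ∀ a ∈ exploreAvoiding G x.1 x.2 k, ¬ G.Adj x.1 a}) := by
        refine measureReal_mono ?_ (measure_ne_top _ _)
        rintro G ⟨v, w, hvw, hG⟩
        simp only [Set.mem_iUnion]
        exact ⟨(v, w), by simpa [T] using hvw, hG⟩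
    _ ≤ ∑ x ∈ T, Real.exp (-(p * m)) :=
        (measureReal_biUnion_finset_le _ _).trans <| Finset.sum_le_sum fun x hx =>
          real_le_exp_of_forall_not_adj p (Finset.mem_filter.1 hx).2 k m
    _ ≤ ∑ x : V × V, Real.exp (-(p * m)) :=
        Finset.sum_le_sum_of_subset_of_nonneg (Finset.subset_univ _) fun _ _ _ =>
          (Real.exp_pos _).le
    _ = _ := by simp [sq]

lemma real_not_adj_of_mem_of_notMem_le (p : I) {S U : Finset V} (hSU : S ⊆ U)
    (hU : U.card ≤ Fintype.card V / 2) :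
    (binomialRandom V p).real {G | ∀ a ∈ S, ∀ b ∉ U, ¬ G.Adj a b} ≤
      Real.exp (-(p * (S.card * (Fintype.card V / 2)))) := by
  classical
  let F : Finset (Sym2 V) := (S ×ˢ Uᶜ).image fun x => s(x.1, x.2)
  have hF : ∀ e ∈ F, ¬ e.IsDiag := by
    intro e he
    obtain ⟨⟨a, b⟩, hab, rfl⟩ := Finset.mem_image.1 he
    obtain ⟨ha, hb⟩ := Finset.mem_product.1 hab
    rw [Sym2.mk_isDiag_iff]
    intro (h : a = b)
    subst h
    exact Finset.mem_compl.1 hb (hSU ha)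
  -- No unordered pair is counted twice, because `S` is disjoint from the complement of `U`.
  have hcard : F.card = S.card * (Fintype.card V - U.card) := by
    rw [Finset.card_image_of_injOn, Finset.card_product, Finset.card_compl]
    rintro ⟨a, b⟩ hab ⟨c, d⟩ hcd h
    simp only [Finset.coe_product, Finset.coe_compl, Set.mem_prod, Finset.mem_coe,
      Set.mem_compl_iff] at hab hcd
    rcases Sym2.eq_iff.1 h with ⟨h1, h2⟩ | ⟨h1, h2⟩
    · exact Prod.ext h1 h2
    · exact absurd (hSU (show d ∈ S from (show a = d from h1) ▸ hab.1)) hcd.2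
  calc _ ≤ (binomialRandom V p).real {G | ∀ e ∈ F, e ∉ G.edgeSet} := by
        refine measureReal_mono ?_ (measure_ne_top _ _)
        intro G hG e he
        obtain ⟨⟨a, b⟩, hab, rfl⟩ := Finset.mem_image.1 he
        obtain ⟨ha, hb⟩ := Finset.mem_product.1 hab
        exact hG a ha b (Finset.mem_compl.1 hb)
    _ = (1 - p : ℝ) ^ F.card := binomialRandom_real_forall_notMem p F hF
    _ ≤ _ := by
        refine one_sub_pow_le_exp p ?_
        rw [hcard, Nat.cast_mul, Nat.cast_sub (hU.trans (Nat.div_le_self _ _))]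
        have : (U.card : ℝ) ≤ Fintype.card V / 2 := by
          have h2 : U.card * 2 ≤ Fintype.card V := (Nat.le_div_iff_mul_le two_pos).1 hU
          have : (U.card : ℝ) * 2 ≤ Fintype.card V := by exact_mod_cast h2
          linarith
        gcongr
        linarith

/-- A failing `U` can be enlarged to have exactly the maximal size allowed. For `|S| = s` this
leaves at most `n ^ ((q + 1) * s)` pairs, so the union bound gives `ρ ^ s ≤ ρ`. -/
lemma real_not_isExpanding_le (p : I) (q : ℕ) {ρ : ℝ} (hρ1 : ρ ≤ 1)
    (hρ : (Fintype.card V : ℝ) ^ (q + 1) * Real.exp (-(p * (Fintype.card V / 2))) ≤ ρ) :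
    (binomialRandom V p).real {G | ¬ IsExpanding G q} ≤ Fintype.card V * ρ := by
  classical
  set n := Fintype.card V with hn
  let t : ℕ → ℕ := fun s => min (n / 2) (q * s)
  let T : ℕ → Finset (Finset V × Finset V) := fun s =>
    ((Finset.powersetCard s Finset.univ) ×ˢ (Finset.powersetCard (t s) Finset.univ)).filter
      fun x => x.1 ⊆ x.2
  let E : Finset V × Finset V → Set (SimpleGraph V) := fun x =>
    {G | ∀ a ∈ x.1, ∀ b ∉ x.2, ¬ G.Adj a b}
  have hsub : {G : SimpleGraph V | ¬ IsExpanding G q} ⊆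
      ⋃ s ∈ Finset.Icc 1 n, ⋃ x ∈ T s, E x := by
    intro G hG
    simp only [IsExpanding, Set.mem_ofPred_eq, not_forall, not_exists, not_and] at hG
    obtain ⟨S, U, hS, hSU, hU, hG⟩ := hG
    obtain ⟨U', hUU', -, hU'⟩ := Finset.exists_subsuperset_card_eq (Finset.subset_univ U) hU
      (by rw [Finset.card_univ]; exact (min_le_left _ _).trans (Nat.div_le_self _ _))
    simp only [Set.mem_iUnion]
    refine ⟨S.card, Finset.mem_Icc.2 ⟨hS.card_pos, Finset.card_le_univ S⟩, (S, U'), ?_, ?_⟩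
    · simp only [T, Finset.mem_filter, Finset.mem_product, Finset.mem_powersetCard]
      exact ⟨⟨⟨Finset.subset_univ _, trivial⟩, Finset.subset_univ _, hU'⟩, hSU.trans hUU'⟩
    · exact fun a ha b hb => hG a ha b fun h => hb (hUU' h)
  have hterm : ∀ s ∈ Finset.Icc 1 n, (binomialRandom V p).real (⋃ x ∈ T s, E x) ≤ ρ := by
    intro s hs
    have hs := Finset.mem_Icc.1 hs
    have hn1 : 1 ≤ n := hs.1.trans hs.2
    have h1 : (binomialRandom V p).real (⋃ x ∈ T s, E x) ≤
        ∑ x ∈ T s, Real.exp (-(p * (s * (n / 2)))) := by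
      refine (measureReal_biUnion_finset_le _ _).trans <| Finset.sum_le_sum fun x hx => ?_
      simp only [T, Finset.mem_filter, Finset.mem_product, Finset.mem_powersetCard] at hx
      obtain ⟨⟨⟨-, hx1⟩, -, hx2⟩, hx3⟩ := hx
      rw [← hx1]
      exact real_not_adj_of_mem_of_notMem_le p hx3 (hx2.trans_le (min_le_left _ _))
    have h2 : (T s).card ≤ n ^ s * n ^ (q * s) := by
      refine (Finset.card_filter_le _ _).trans ?_
      rw [Finset.card_product, Finset.card_powersetCard, Finset.card_powersetCard,
        Finset.card_univ]
      exact Nat.mul_le_mul (Nat.choose_le_pow _ _) ((Nat.choose_le_pow _ _).trans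
        (Nat.pow_le_pow_right hn1 (min_le_right _ _)))
    calc _ ≤ _ := h1
      _ = ((T s).card : ℝ) * Real.exp (-(p * (s * (n / 2)))) := by simp
      _ ≤ ((n : ℝ) ^ s * (n : ℝ) ^ (q * s)) * Real.exp (-(p * (s * (n / 2)))) := by
        gcongr
        exact_mod_cast h2
      _ = ((n : ℝ) ^ (q + 1) * Real.exp (-(p * (n / 2)))) ^ s := by
        rw [mul_pow, ← Real.exp_nat_mul, ← pow_mul, ← pow_add]
        ring_nf
      _ ≤ ρ ^ s := by gcongr
      _ ≤ ρ := pow_le_of_le_one (le_trans (by positivity) hρ) hρ1 (by omega)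
  calc _ ≤ _ := measureReal_mono hsub (measure_ne_top _ _)
    _ ≤ ∑ s ∈ Finset.Icc 1 n, ρ :=
      (measureReal_biUnion_finset_le _ _).trans (Finset.sum_le_sum hterm)
    _ = n * ρ := by simp

/-- Union bound over `m`-sets of neighbours: with `m ^ m / m! ≤ exp m`, the constant `exp 2` in `hm`
leaves `exp (-2 * m) * exp m` per vertex. -/
lemma real_exists_le_ncard_neighborSet (p : I) {m : ℕ}
    (hm : Real.exp 2 * ((Fintype.card V - 1) * p) ≤ m) :
    (binomialRandom V p).real {G : SimpleGraph V | ∃ v, m ≤ (G.neighborSet v).ncard} ≤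
      Fintype.card V * Real.exp (-m) := by
  classical
  set n := Fintype.card V with hn
  let T : V → Finset (Finset V) := fun v => Finset.powersetCard m (Finset.univ.erase v)
  have hsub : {G : SimpleGraph V | ∃ v, m ≤ (G.neighborSet v).ncard} ⊆
      ⋃ v ∈ (Finset.univ : Finset V), ⋃ B ∈ T v,
        {G | ∀ e ∈ B.image (fun b => s(v, b)), e ∈ G.edgeSet} := by
    rintro G ⟨v, hv⟩
    rw [Set.ncard_eq_toFinset_card' ] at hv
    obtain ⟨B, hB, hBm⟩ := Finset.exists_subset_card_eq hv
    simp only [Set.mem_iUnion]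
    refine ⟨v, Finset.mem_univ v, B, Finset.mem_powersetCard.2 ⟨fun b hb => ?_, hBm⟩,
      fun e he => ?_⟩
    · have : G.Adj v b := by simpa using hB hb
      simpa using this.ne'
    · obtain ⟨b, hb, rfl⟩ := Finset.mem_image.1 he
      simpa using hB hb
  have hterm : ∀ v ∈ (Finset.univ : Finset V), (binomialRandom V p).real (⋃ B ∈ T v,
      {G | ∀ e ∈ B.image (fun b => s(v, b)), e ∈ G.edgeSet}) ≤ Real.exp (-m) := by
    intro v _
    have hn1 : 1 ≤ n := Fintype.card_pos_iff.2 ⟨v⟩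
    have h0 : 0 ≤ ((n : ℝ) - 1) * p :=
      mul_nonneg (by rw [sub_nonneg]; exact_mod_cast hn1) p.2.1
    have h1 : (binomialRandom V p).real (⋃ B ∈ T v,
        {G | ∀ e ∈ B.image (fun b => s(v, b)), e ∈ G.edgeSet}) ≤ ∑ B ∈ T v, (p : ℝ) ^ m := by
      refine (measureReal_biUnion_finset_le _ _).trans <| Finset.sum_le_sum fun B hB => ?_
      obtain ⟨hB1, hB2⟩ := Finset.mem_powersetCard.1 hB
      rw [binomialRandom_real_forall_mem p _ (not_isDiag_of_mem_image_mk fun h => by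
        simpa using hB1 h), card_image_mk, hB2]
    have h2 : ((n - 1).choose m : ℝ) ≤ ((n : ℝ) - 1) ^ m / m.factorial := by
      have := Nat.choose_le_pow_div (α := ℝ) m (n - 1)
      rwa [Nat.cast_sub hn1, Nat.cast_one] at this
    have h3 : ((n : ℝ) - 1) * p ≤ Real.exp (-2) * m := by
      rw [Real.exp_neg, ← div_eq_inv_mul, le_div_iff₀ (Real.exp_pos _)]
      linarith
    calc _ ≤ _ := h1
      _ = ((n - 1).choose m : ℝ) * (p : ℝ) ^ m := by
        rw [Finset.sum_const, Finset.card_powersetCard, Finset.card_erase_of_mem (Finset.mem_univ v),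
          Finset.card_univ, nsmul_eq_mul]
      _ ≤ ((n : ℝ) - 1) ^ m / m.factorial * (p : ℝ) ^ m := by
        have := p.2.1
        gcongr
      _ = (((n : ℝ) - 1) * p) ^ m / m.factorial := by rw [mul_pow]; ring
      _ ≤ (Real.exp (-2) * m) ^ m / m.factorial := by
        exact div_le_div_of_nonneg_right (pow_le_pow_left₀ h0 h3 m) (Nat.cast_nonneg _)
      _ = Real.exp (-2) ^ m * ((m : ℝ) ^ m / m.factorial) := by rw [mul_pow]; ring
      _ ≤ Real.exp (-2) ^ m * Real.exp m := by
        gcongr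
        exact Real.pow_div_factorial_le_exp (m : ℝ) (Nat.cast_nonneg m) m
      _ = Real.exp (-m) := by
        rw [← Real.exp_nat_mul, ← Real.exp_add]; ring_nf
  calc _ ≤ _ := measureReal_mono hsub (measure_ne_top _ _)
    _ ≤ ∑ v : V, Real.exp (-m) :=
      (measureReal_biUnion_finset_le _ _).trans (Finset.sum_le_sum hterm)
    _ = _ := by simp [hn]

/-- With high probability, `G(n, p)` has maximal degree of order `(n - 1) * p` and diameter at
most `k + 1`, as soon as balls of radius `k` are forced to be large. -/
theorem le_real_edist_le_and_ncard_neighborSet_le (p : I) {q k : ℕ} (hq : 1 ≤ q)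
    (hn : 1 ≤ Fintype.card V)
    (h1 : (q + 3) * Real.log (Fintype.card V) ≤ p * (Fintype.card V / 2))
    (h2 : 3 * Real.log (Fintype.card V) ≤ p * (min (Fintype.card V / 2) (q ^ k) : ℕ))
    (h3 : 2 * Real.log (Fintype.card V) ≤ Real.exp 2 * ((Fintype.card V - 1) * p)) :
    1 - 3 / (Fintype.card V : ℝ) ≤ (binomialRandom V p).real
      {G : SimpleGraph V | (∀ u v, G.edist u v ≤ (k + 1 : ℕ)) ∧
        ∀ v, ((G.neighborSet v).ncard : ℝ) ≤ Real.exp 2 * ((Fintype.card V - 1) * p)} := by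
  set n := Fintype.card V with hn'
  have hn0 : (0 : ℝ) < n := by exact_mod_cast hn
  set m := ⌈Real.exp 2 * ((n - 1) * p)⌉₊ with hm
  set l := min (n / 2) (q ^ k) with hl
  have hexp : ∀ j : ℕ, Real.exp (-(j * Real.log n)) = ((n : ℝ) ^ j)⁻¹ := fun j => by
    rw [Real.exp_neg, Real.exp_nat_mul, Real.exp_log hn0]
  have b1 : (binomialRandom V p).real {G | ¬ IsExpanding G q} ≤ 1 / n := by
    -- The `n` sizes of `S` cost a factor `n`, hence the target `n ^ (-2)`.
    refine (real_not_isExpanding_le p q (ρ := ((n : ℝ) ^ 2)⁻¹) ?_ ?_).trans_eq ?_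
    · exact inv_le_one_of_one_le₀ (one_le_pow₀ (by exact_mod_cast hn))
    · rw [← hn', ← hexp 2]
      have : (n : ℝ) ^ (q + 1) = Real.exp ((q + 1) * Real.log n) := by
        rw [← Nat.cast_succ, Real.exp_nat_mul, Real.exp_log hn0]
      rw [this, ← Real.exp_add, Real.exp_le_exp]
      push_cast
      linarith
    · rw [← hn']; field_simp
  have b2 := real_exists_forall_not_adj_le (V := V) p k l
  have b2' : (n : ℝ) ^ 2 * Real.exp (-(p * l)) ≤ 1 / (n : ℝ) := by
    calc (n : ℝ) ^ 2 * Real.exp (-(p * l)) ≤ (n : ℝ) ^ 2 * Real.exp (-((3 : ℕ) * Real.log n)) := by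
          refine mul_le_mul_of_nonneg_left (Real.exp_le_exp.2 (neg_le_neg ?_)) (by positivity)
          exact_mod_cast h2
      _ = 1 / (n : ℝ) := by rw [hexp]; field_simp
  have b3 := real_exists_le_ncard_neighborSet (V := V) p (m := m) (Nat.le_ceil _)
  have b3' : n * Real.exp (-m) ≤ 1 / (n : ℝ) := by
    calc n * Real.exp (-m) ≤ n * Real.exp (-((2 : ℕ) * Real.log n)) := by
          gcongr
          exact (by exact_mod_cast h3 : _ ≤ Real.exp 2 * ((n - 1) * p)).trans (Nat.le_ceil _)
      _ = 1 / (n : ℝ) := by rw [hexp]; field_simp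
  set good := {G : SimpleGraph V | (∀ u v, G.edist u v ≤ (k + 1 : ℕ)) ∧
        ∀ v, ((G.neighborSet v).ncard : ℝ) ≤ Real.exp 2 * ((n - 1) * p)} with hgood
  have hsub : goodᶜ ⊆ ({G | ¬ IsExpanding G q} ∪
      {G | ∃ v w, w ≠ v ∧ l ≤ (exploreAvoiding G v w k).card ∧
        ∀ a ∈ exploreAvoiding G v w k, ¬ G.Adj v a}) ∪
      {G : SimpleGraph V | ∃ v, m ≤ (G.neighborSet v).ncard} := by
    intro G hG
    by_contra hcon
    simp only [Set.mem_union, Set.mem_ofPred_eq, not_or, not_not] at hcon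
    obtain ⟨⟨c1, c2⟩, c3⟩ := hcon
    refine hG ⟨fun u v => edist_le_of_exists_adj_exploreAvoiding (fun v w hvw => ?_) v u,
      fun v => ?_⟩
    · by_contra hc
      push Not at hc
      exact c2 ⟨v, w, hvw, c1.le_card_exploreAvoiding hq hvw k, hc⟩
    · push Not at c3
      exact (Nat.lt_ceil.1 (c3 v)).le
  have hcompl : (binomialRandom V p).real goodᶜ = 1 - (binomialRandom V p).real good :=
    probReal_compl_eq_one_sub .of_discrete
  have hle : (binomialRandom V p).real goodᶜ ≤ 1 / n + 1 / n + 1 / n :=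
    (measureReal_mono hsub (measure_ne_top _ _)).trans <| (measureReal_union_le _ _).trans <|
      add_le_add ((measureReal_union_le _ _).trans (add_le_add b1 (b2.trans b2'))) (b3.trans b3')
  have : (3 : ℝ) / n = 1 / n + 1 / n + 1 / n := by ring
  linarith

end Typical

end MultisetDim

namespace MultisetDim

open MeasureTheory ProbabilityTheory unitInterval SimpleGraph

/-! ### The equation defining the exponent. -/

section Exponent

lemma continuous_exponentFun (x : ℝ) : Continuous (exponentFun x) := by
  unfold exponentFun
  fun_prop

lemma exponentFun_zero {x : ℝ} (hx : 0 < x) : exponentFun x 0 = 0 := by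
  refine Finset.sum_eq_zero fun i hi => max_eq_right ?_
  have hi : i ≤ ⌊1 / x⌋₊ := Nat.lt_succ_iff.1 (Finset.mem_range.1 hi)
  have : (i : ℝ) ≤ 1 / x := (Nat.le_floor_iff (by positivity)).1 hi
  rw [le_div_iff₀ hx] at this
  linarith

lemma one_lt_floor_succ_mul {x : ℝ} (hx : 0 < x) : 1 < ((⌊1 / x⌋₊ + 1 : ℕ) : ℝ) * x := by
  have := Nat.lt_floor_add_one (1 / x)
  rw [div_lt_iff₀ hx] at this
  exact_mod_cast this

/-- The terms `i = 1` and `i = k = ⌊1/x⌋` already give `(k + 1) * x > 1`; they are distinct because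
`x ≤ 1/2`. -/
lemma one_lt_exponentFun_one {x : ℝ} (hx : x ∈ Set.Ioc (0 : ℝ) (1 / 2)) : 1 < exponentFun x 1 := by
  obtain ⟨hx0, hx2⟩ := hx
  set k := ⌊1 / x⌋₊ with hk
  have hk2 : 2 ≤ k := by
    rw [hk, Nat.le_floor_iff (by positivity), le_div_iff₀ hx0]
    push_cast
    linarith
  have hkx := one_lt_floor_succ_mul hx0
  rw [← hk] at hkx
  push_cast at hkx
  have hsub : ({1, k} : Finset ℕ) ⊆ Finset.range (k + 1) := by
    intro i hi
    simp only [Finset.mem_insert, Finset.mem_singleton] at hi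
    rw [Finset.mem_range]
    omega
  have := Finset.sum_le_sum_of_subset_of_nonneg (f := fun i : ℕ => max ((i : ℝ) * x + 1 - 1) 0)
    hsub fun _ _ _ => le_max_right _ _
  rw [Finset.sum_pair (by omega)] at this
  have h1 := le_max_left (((1 : ℕ) : ℝ) * x + 1 - 1) 0
  have h2 := le_max_left ((k : ℝ) * x + 1 - 1) 0
  rw [exponentFun, ← hk]
  push_cast at h1
  push_cast at this
  linarith

lemma exists_pos_of_exponentFun_pos {x y : ℝ} (h : 0 < exponentFun x y) :
    ∃ i ∈ Finset.range (⌊1 / x⌋₊ + 1), 0 < (i : ℝ) * x + y - 1 := by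
  by_contra! hcon
  exact h.ne' (Finset.sum_eq_zero fun i hi => max_eq_right (hcon i hi))

/-- Where the sum is positive some term is positive, and that term strictly increases. Hence level 1
is attained at most once. -/
lemma exponentFun_lt {x y y' : ℝ} (h : 0 < exponentFun x y) (hy : y < y') :
    exponentFun x y < exponentFun x y' := by
  obtain ⟨i, hi, hpos⟩ := exists_pos_of_exponentFun_pos h
  refine Finset.sum_lt_sum (fun j _ => max_le_max_right _ (by linarith)) ⟨i, hi, ?_⟩
  rw [max_eq_left hpos.le]
  exact lt_max_of_lt_left (by linarith)

lemma exists_exponentFun_eq_one {x : ℝ} (hx : x ∈ Set.Ioc (0 : ℝ) (1 / 2)) :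
    ∃ y ∈ Set.Ioo (0 : ℝ) 1, exponentFun x y = 1 :=
  intermediate_value_Ioo zero_le_one (continuous_exponentFun x).continuousOn
    ⟨(exponentFun_zero hx.1).trans_lt one_pos, one_lt_exponentFun_one hx⟩

lemma eq_of_exponentFun_eq_one {x y y' : ℝ} (h : exponentFun x y = 1) (h' : exponentFun x y' = 1) :
    y = y' := by
  rcases lt_trichotomy y y' with hlt | heq | hlt
  · exact absurd (exponentFun_lt (h ▸ one_pos) hlt) (by rw [h, h']; exact lt_irrefl _)
  · exact heq
  · exact absurd (exponentFun_lt (h' ▸ one_pos) hlt) (by rw [h, h']; exact lt_irrefl _)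

end Exponent

/-! ### Choice of constants for large `n`. -/

section Asymptotics

lemma rpow_add_div_log {n : ℝ} (hn : 1 < n) (x A : ℝ) :
    n ^ (x + A / Real.log n) = n ^ x * Real.exp A := by
  have hn0 : 0 < n := by linarith
  rw [Real.rpow_add hn0, Real.rpow_def_of_pos hn0 (A / _),
    mul_div_cancel₀ _ (Real.log_pos hn).ne']

lemma rpow_sub_div_log {n : ℝ} (hn : 1 < n) (x A : ℝ) :
    n ^ (x - A / Real.log n) = n ^ x * Real.exp (-A) := by
  rw [sub_eq_add_neg, ← neg_div, rpow_add_div_log hn]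

lemma eventually_const_mul_log_pow_le (c : ℝ) {ε : ℝ} (hε : 0 < ε) (k : ℕ) :
    ∀ᶠ n : ℕ in atTop, c * Real.log n ^ k ≤ (n : ℝ) ^ ε := by
  have h := ((isLittleO_log_rpow_rpow_atTop (k : ℝ) hε).const_mul_left c).bound one_pos
  filter_upwards [tendsto_natCast_atTop_atTop.eventually h] with n hn
  rw [one_mul, Real.norm_of_nonneg (Real.rpow_nonneg (Nat.cast_nonneg n) ε),
    Real.rpow_natCast] at hn
  exact (Real.le_norm_self _).trans hn

/-- The choice is `q = ⌊d / (8 log n)⌋`, with `d = (n - 1) * p`. As `(k + 1) * x > 1`, `d ^ (k + 1)`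
exceeds `n` by a power of `n`, which absorbs all logarithms. -/
lemma eventually_exists_expansion {x : ℝ} (hx : 0 < x) (A : ℝ) {k : ℕ}
    (hk : 1 < ((k + 1 : ℕ) : ℝ) * x) :
    ∀ᶠ n : ℕ in atTop, ∀ p : I, (n : ℝ) ^ (x - A / Real.log n) ≤ ((n : ℝ) - 1) * p →
      ∃ q : ℕ, 1 ≤ q ∧ (q + 3) * Real.log n ≤ p * (n / 2) ∧
        3 * Real.log n ≤ p * (min (n / 2) (q ^ k) : ℕ) ∧
        2 * Real.log n ≤ Real.exp 2 * (((n : ℝ) - 1) * p) := by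
  have hε : 0 < ((k + 1 : ℕ) : ℝ) * x - 1 := by linarith
  filter_upwards [eventually_ge_atTop 3, eventually_const_mul_log_pow_le (48 * Real.exp A) hx 1,
    eventually_const_mul_log_pow_le (3 * 16 ^ k * Real.exp A ^ (k + 1)) hε (k + 1)]
    with n hn h1 h2 p hp
  have hn3 : (3 : ℝ) ≤ n := by exact_mod_cast hn
  have hn0 : (0 : ℝ) < n := by linarith
  set L := Real.log n with hL
  have hL0 : 0 < L := Real.log_pos (by linarith)
  rw [rpow_sub_div_log (by linarith)] at hp
  set d := ((n : ℝ) - 1) * p with hd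
  have hp0 : (0 : ℝ) ≤ p := p.2.1
  have hAA : Real.exp A * Real.exp (-A) = 1 := by rw [← Real.exp_add]; simp
  have hd1 : 48 * L ≤ d := by
    calc 48 * L = (48 * Real.exp A * L ^ 1) * Real.exp (-A) := by linear_combination (-48 * L) * hAA
      _ ≤ (n : ℝ) ^ x * Real.exp (-A) := by gcongr
      _ ≤ d := hp
  have hd0 : 0 < d := by linarith
  have hd2 : 3 * L * (16 * L) ^ k * n ≤ d ^ (k + 1) := by
    calc 3 * L * (16 * L) ^ k * n
        = (3 * 16 ^ k * Real.exp A ^ (k + 1) * L ^ (k + 1)) * Real.exp (-A) ^ (k + 1) * n := by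
          have : Real.exp A ^ (k + 1) * Real.exp (-A) ^ (k + 1) = 1 := by
            rw [← mul_pow, hAA, one_pow]
          rw [mul_pow]
          linear_combination (-3 * 16 ^ k * L ^ (k + 1) * n) * this
      _ ≤ (n : ℝ) ^ (((k + 1 : ℕ) : ℝ) * x - 1) * Real.exp (-A) ^ (k + 1) * n := by gcongr
      _ = ((n : ℝ) ^ x * Real.exp (-A)) ^ (k + 1) := by
          rw [mul_pow, ← Real.rpow_mul_natCast hn0.le, Real.rpow_sub_one hn0.ne', mul_comm x]
          field_simp
      _ ≤ d ^ (k + 1) := by gcongr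
  have hdn : d ≤ n * p := by rw [hd]; gcongr; linarith
  set y := d / (8 * L) with hy
  have hy1 : 1 ≤ y := by rw [hy, le_div_iff₀ (by positivity)]; linarith
  have hq1 : 1 ≤ ⌊y⌋₊ := (Nat.le_floor_iff (by linarith)).2 (by exact_mod_cast hy1)
  have hq1' : (1 : ℝ) ≤ ⌊y⌋₊ := by exact_mod_cast hq1
  have hqle : (⌊y⌋₊ : ℝ) * L ≤ d / 8 := by
    calc (⌊y⌋₊ : ℝ) * L ≤ y * L := by gcongr; exact Nat.floor_le (by linarith)
      _ = d / 8 := by rw [hy]; field_simp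
  -- For `y ≥ 1` the floor loses at most a factor of two.
  have hqge : d / (16 * L) ≤ ⌊y⌋₊ := by
    have h3 := Nat.lt_floor_add_one y
    have h4 : d / (16 * L) = y / 2 := by rw [hy]; field_simp; norm_num
    linarith
  refine ⟨⌊y⌋₊, hq1, by linarith, ?_, ?_⟩
  · rcases min_choice (n / 2) (⌊y⌋₊ ^ k) with h | h <;> rw [h]
    · have : n ≤ n / 2 * 2 + 1 := by omega
      have : (n : ℝ) ≤ (n / 2 : ℕ) * 2 + 1 := by exact_mod_cast this
      have h5 : (p : ℝ) * (((n : ℝ) - 1) / 2) ≤ p * (n / 2 : ℕ) := by gcongr; linarith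
      have h6 : (p : ℝ) * (((n : ℝ) - 1) / 2) = d / 2 := by rw [hd]; ring
      linarith
    · rw [Nat.cast_pow]
      have h7 : 3 * L ≤ d / n * (d / (16 * L)) ^ k := by
        rw [div_pow, div_mul_div_comm, ← pow_succ', le_div_iff₀ (by positivity)]
        linarith
      have h8 : d / n ≤ p := by rw [div_le_iff₀ hn0]; linarith
      exact h7.trans (by gcongr)
  · have : (1 : ℝ) ≤ Real.exp 2 := Real.one_le_exp (by norm_num)
    nlinarith

lemma eventually_le_rpow (c : ℝ) {α : ℝ} (hα : 0 < α) :
    ∀ᶠ n : ℕ in atTop, c ≤ (n : ℝ) ^ α := by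
  simpa using eventually_const_mul_log_pow_le c hα 0

/-- A resolving set in a typical sparse graph has at least `n ^ (y - C / log n)` elements, where
`y` solves `exponentFun x y = 1`. -/
theorem exists_eventually_le_card_of_isMultisetResolving {x y : ℝ} (hxy : exponentFun x y = 1)
    (A : ℝ) : ∃ C : ℝ, 0 < C ∧ ∀ᶠ n : ℕ in atTop, ∀ (d : ℝ), 0 ≤ d →
      d ≤ (n : ℝ) ^ (x + A / Real.log n) → ∀ G : SimpleGraph (Fin n),
      (∀ u v, G.edist u v ≤ (⌊1 / x⌋₊ + 1 : ℕ)) →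
      (∀ v, ((G.neighborSet v).ncard : ℝ) ≤ Real.exp 2 * d) →
      ∀ R : Finset (Fin n), IsMultisetResolving G R →
        (n : ℝ) ^ (y - C / Real.log n) ≤ R.card := by
  set l := ⌊1 / x⌋₊ + 1 with hl
  -- `|A|` rather than `A` ensures `B ≥ 1`, so that `B ^ i ≤ B ^ l`.
  set B := Real.exp 2 * Real.exp |A| with hB
  have hB1 : 1 ≤ B := one_le_mul_of_one_le_of_one_le (Real.one_le_exp (by norm_num))
    (Real.one_le_exp (abs_nonneg A))
  have hl1 : (1 : ℝ) ≤ l := by rw [hl]; push_cast; linarith [Nat.cast_nonneg (α := ℝ) ⌊1 / x⌋₊]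
  set M := 2 * l * B ^ l with hM
  have hM1 : 1 ≤ M := by
    have := one_le_pow₀ hB1 (n := l)
    nlinarith
  let α : ℕ → ℝ := fun i => (i : ℝ) * x + y - 1
  have hev : ∀ᶠ n : ℕ in atTop, ∀ i ∈ Finset.range l, 0 < α i → 8 ≤ (n : ℝ) ^ α i := by
    rw [Filter.eventually_all_finset]
    intro i _
    by_cases h : 0 < α i
    · filter_upwards [eventually_le_rpow 8 h] with n hn _ using hn
    · exact Eventually.of_forall fun n h' => absurd h' h
  -- Here `M` absorbs the Markov factor `2 * l` and the degree constants, and 8 yields thresholds `n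
  -- ^ α i / 8`.
  refine ⟨Real.log (8 * M), Real.log_pos (by linarith), ?_⟩
  filter_upwards [hev, eventually_ge_atTop 2] with n h8 hn d hd0 hd G hdiam hdeg R hR
  have hn2 : (2 : ℝ) ≤ n := by exact_mod_cast hn
  have hn0 : (0 : ℝ) < n := by linarith
  by_contra! hcard
  rw [rpow_sub_div_log (by linarith), Real.exp_neg, Real.exp_log (by linarith)] at hcard
  rw [rpow_add_div_log (by linarith)] at hd
  have hD : Real.exp 2 * d ≤ B * (n : ℝ) ^ x := by
    calc Real.exp 2 * d ≤ Real.exp 2 * ((n : ℝ) ^ x * Real.exp |A|) := by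
          gcongr
          exact hd.trans (by gcongr; exact le_abs_self A)
      _ = B * (n : ℝ) ^ x := by rw [hB]; ring
  have hkey := card_le_of_isMultisetResolving hdiam hR (by positivity) hdeg
    (z := fun i => (n : ℝ) ^ α i / 8) (fun i _ => by positivity) (fun i hi => by
      calc 2 * (l : ℝ) * (R.card * (Real.exp 2 * d) ^ i)
          ≤ 2 * (l : ℝ) * (((n : ℝ) ^ y * (8 * M)⁻¹) * (B * (n : ℝ) ^ x) ^ i) := by gcongr
        _ = 2 * l * B ^ i * ((n : ℝ) ^ y * (8 * M)⁻¹ * ((n : ℝ) ^ x) ^ i) := by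
            rw [mul_pow]; ring
        _ ≤ M * ((n : ℝ) ^ y * (8 * M)⁻¹ * ((n : ℝ) ^ x) ^ i) := by
            rw [hM]
            gcongr
        _ = (n : ℝ) ^ y * ((n : ℝ) ^ x) ^ i / 8 := by
            field_simp
        _ = (n : ℝ) ^ α i / 8 * Fintype.card (Fin n) := by
            rw [Fintype.card_fin, ← Real.rpow_mul_natCast hn0.le, ← Real.rpow_add hn0,
              Real.rpow_sub_one hn0.ne', mul_comm x, add_comm]
            field_simp)
  rw [Fintype.card_fin] at hkey
  obtain ⟨j, hj, hjpos⟩ := exists_pos_of_exponentFun_pos (hxy ▸ one_pos : 0 < exponentFun x y)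
  -- A single index `j` with positive exponent, saving a factor 4, suffices: the final bound is `n ≤
  -- 2 * (n / 4)`.
  have hfac : ∀ i ∈ Finset.range l, ((⌊(n : ℝ) ^ α i / 8⌋₊ : ℝ) + 1) ≤
      (if i = j then 1 / 4 else 1) * (n : ℝ) ^ max (α i) 0 := by
    intro i hi
    by_cases hpos : 0 < α i
    · rw [max_eq_left hpos.le]
      have h1 := h8 i hi hpos
      have h2 : (⌊(n : ℝ) ^ α i / 8⌋₊ : ℝ) ≤ (n : ℝ) ^ α i / 8 := Nat.floor_le (by positivity)
      split_ifs <;> linarith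
    · have hij : i ≠ j := by rintro rfl; exact hpos hjpos
      have h1 : (n : ℝ) ^ α i ≤ 1 :=
        Real.rpow_le_one_of_one_le_of_nonpos (by linarith) (not_lt.1 hpos)
      have h2 : ⌊(n : ℝ) ^ α i / 8⌋₊ = 0 := Nat.floor_eq_zero.2 (by linarith)
      rw [max_eq_right (not_lt.1 hpos), if_neg hij, h2]
      simp
  have hprod := Finset.prod_le_prod (fun i _ => by positivity) hfac
  rw [Finset.prod_mul_distrib, Finset.prod_ite_eq' _ j, if_pos hj, ← Real.rpow_sum_of_pos hn0] at hprod
  have hexp : ∑ i ∈ Finset.range l, max (α i) 0 = 1 := hxy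
  rw [hexp, Real.rpow_one] at hprod
  linarith

end Asymptotics

end MultisetDim

/-! ### Assembly of the theorem. -/

open MeasureTheory in
theorem mainTheorem2 (x : ℝ) (hx : x ∈ Set.Ioc (0 : ℝ) (1 / 2)) :
    ∃ y₁ : ℝ, y₁ ∈ Set.Ioo (0 : ℝ) 1 ∧ MultisetDim.exponentFun x y₁ = 1 ∧
      (∀ y ∈ Set.Ioo (0 : ℝ) 1, MultisetDim.exponentFun x y = 1 → y = y₁) ∧
      ∀ A : ℝ, ∃ C : ℝ, 0 < C ∧ ∀ p : ℕ → unitInterval,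
        (∀ᶠ n : ℕ in atTop,
          (n : ℝ) ^ (x - A / Real.log n) ≤ ((n : ℝ) - 1) * (p n : ℝ) ∧
          ((n : ℝ) - 1) * (p n : ℝ) ≤ (n : ℝ) ^ (x + A / Real.log n)) →
        Tendsto
          (fun n : ℕ => SimpleGraph.binomialRandom (Fin n) (p n)
            {G : SimpleGraph (Fin n) | ¬ ∃ R : Finset (Fin n),
              MultisetDim.IsMultisetResolving G R ∧
              (R.card : ℝ) < (n : ℝ) ^ (y₁ - C / Real.log n)})
          atTop (𝓝 1) := by
  obtain ⟨y, hy, hxy⟩ := MultisetDim.exists_exponentFun_eq_one hx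
  refine ⟨y, hy, hxy, fun y' _ h => MultisetDim.eq_of_exponentFun_eq_one h hxy, fun A => ?_⟩
  obtain ⟨C, hC, hev⟩ := MultisetDim.exists_eventually_le_card_of_isMultisetResolving hxy A
  refine ⟨C, hC, fun p hp => ?_⟩
  have hlim : Tendsto (fun n : ℕ => ENNReal.ofReal (1 - 3 / (n : ℝ))) atTop (𝓝 1) := by
    have := (tendsto_const_div_atTop_nhds_zero_nat (3 : ℝ)).const_sub 1
    simpa using ENNReal.tendsto_ofReal this
  refine tendsto_of_tendsto_of_tendsto_of_le_of_le' hlim tendsto_const_nhds ?_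
    (Eventually.of_forall fun n => prob_le_one)
  filter_upwards [hp, hev, MultisetDim.eventually_exists_expansion hx.1 A
    (MultisetDim.one_lt_floor_succ_mul hx.1), eventually_ge_atTop 1] with n hpn hevn hexp hn
  obtain ⟨q, hq, h1, h2, h3⟩ := hexp (p n) hpn.1
  have htyp := MultisetDim.le_real_edist_le_and_ncard_neighborSet_le (V := Fin n) (p n)
    (q := q) (k := ⌊1 / x⌋₊) hq (by simpa using hn) (by simpa using h1) (by simpa using h2)
    (by simpa using h3)
  rw [Fintype.card_fin] at htyp
  have hd0 : 0 ≤ ((n : ℝ) - 1) * p n :=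
    mul_nonneg (by rw [sub_nonneg]; exact_mod_cast hn) (p n).2.1
  refine (ENNReal.ofReal_le_ofReal htyp).trans ?_
  rw [ofReal_measureReal]
  -- The typical event lies inside the target event, by the deterministic bound uniform in `d` and
  -- `G`.
  refine measure_mono ?_
  rintro G ⟨hdiam, hdeg⟩ ⟨R, hR, hcard⟩
  exact hcard.not_ge (hevn _ hd0 hpn.2 G hdiam hdeg R hR)
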